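/- Let $S$ be a semigroup with center $Z(S)=\{s\in S : xs=sx \text{ for all } x\in S\}$, let $\sigma:S\to S$ be an automorphism with $\sigma(\sigma(x))=x$ for all $x\in S$, and let $\mu=\sum_{i\in I}c_i\,\delta_{z_i}$ be a finite linear combination, with coefficients $c_i\in\mathbb{C}$, of Dirac measures at points $z_i\in Z(S)$, so that $\int_S h\,d\mu=\sum_{i\in I}c_i\,h(z_i)$ for every $h:S\to\mathbb{C}$. For $h:S\to\mathbb{C}$ write $h^*:=h\circ\sigma$. A function $h:S\to\mathbb{C}$ is multiplicative if $h(xy)=h(x)h(y)$ for all $x,y\in S$ (the zero function is allowed), and abelian if $h(xy)=h(yx)$ and $h(xyz)=h(xzy)$ for all $x,y,z\in S$. The pairs of functions $f,g:S\to\mathbb{C}$ with $g\neq 0$ that satisfy $$\int_S f(xyt)\,d\mu(t)+\int_S f(\sigma(y)xt)\,d\mu(t)=2f(x)g(y)\qquad\text{for all }x,y\in S$$ are exactly the following: 1. $f=0$ and $g\neq 0$ is arbitrary. 2. $f=\lambda_2 m$ and $g=\Big(\int_S m\,d\mu\Big)\dfrac{m+m^*}{2}$, where $m:S\to\mathbb{C}$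 is multiplicative, $\lambda_2\in\mathbb{C}\setminus\{0\}$, and $\int_S m\,d\mu\neq 0$. 3. $f=\alpha_1\chi+\beta_1\chi^*$ and $g=\Big(\int_S\chi\,d\mu\Big)\dfrac{\chi+\chi^*}{2}$, where $\chi:S\to\mathbb{C}$ is multiplicative, $\alpha_1,\beta_1\in\mathbb{C}$ with $(\alpha_1,\beta_1)\neq(0,0)$, $\chi\neq\chi^*$, and $\int_S\chi\,d\mu=\int_S\chi^*\,d\mu\neq 0$. 4. $f=\lambda(\gamma_1\chi+\varphi)$ and $g=\Big(\int_S\chi\,d\mu\Big)\chi$, where $\chi:S\to\mathbb{C}$ is a non-zero multiplicative function with $\chi^*=\chi$, $\varphi:S\to\mathbb{C}$ is a non-zero solution of the special sine addition law $\varphi(xy)=\varphi(x)\chi(y)+\varphi(y)\chi(x)$ $(x,y\in S)$ with $\varphi^*=-\varphi$, $\lambda\in\mathbb{C}\setminus\{0\}$, $\gamma_1\in\mathbb{C}$, $\int_S\chi\,d\mu\neq 0$ and $\int_S\varphi\,d\mu=0$. Moreover, except in case (1), that is, whenever $f\neq 0$, both $f$ and $g$ are abelian. -/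

import Mathlib

open MeasureTheory

namespace KannappanWilson

/-- `f` is multiplicative: `f (x y) = f x * f y` (the zero function is allowed). -/
def IsMultiplicative {S : Type*} [Semigroup S] (f : S → ℂ) : Prop :=
  ∀ x y : S, f (x * y) = f x * f y

/-- `f` is central: `f (x y) = f (y x)`. -/
def IsCentral {S : Type*} [Semigroup S] (f : S → ℂ) : Prop :=
  ∀ x y : S, f (x * y) = f (y * x)

/-- `f` is abelian: `f` is central and `f (x y z) = f (x z y)`. -/
def IsAbelian {S : Type*} [Semigroup S] (f : S → ℂ) : Prop :=
  IsCentral f ∧ ∀ x y z : S, f (x * y * z) = f (x * z * y)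

/-- The special sine addition law `φ (x y) = φ x * χ y + φ y * χ x`. -/
def SineAdditionLaw {S : Type*} [Semigroup S] (φ χ : S → ℂ) : Prop :=
  ∀ x y : S, φ (x * y) = φ x * χ y + φ y * χ x

/-- The function `f^* = f ∘ σ`. -/
def starFun {S : Type*} [Semigroup S] (σ : S ≃* S) (f : S → ℂ) : S → ℂ :=
  fun x => f (σ x)

/-- The complex measure `∑ i, c i • δ_{z i}`. -/
noncomputable def diracCombination {S I : Type*} [MeasurableSpace S] [Fintype I]
    (c : I → ℂ) (z : I → S) : ComplexMeasure S :=
  ∑ i, c i • VectorMeasure.dirac (z i) (1 : ℂ)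

/-- The integral `∫ f dμ` of a complex function against a complex measure. -/
noncomputable def integral {S : Type*} [MeasurableSpace S] (μ : ComplexMeasure S)
    (f : S → ℂ) : ℂ :=
  VectorMeasure.integral μ f (ContinuousLinearMap.mul ℝ ℂ)

/-- The integral against `∑ i, c i • δ_{z i}` is `∑ i, c i * f (z i)`, for every function `f`. -/
theorem integral_diracCombination {S I : Type*} [MeasurableSpace S] [MeasurableSingletonClass S]
    [Fintype I] (c : I → ℂ) (z : I → S) (f : S → ℂ) :
    integral (diracCombination c z) f = ∑ i, c i * f (z i) := by
  have key : ∀ i, c i • VectorMeasure.dirac (z i) (1 : ℂ) = VectorMeasure.dirac (z i) (c i) := by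
    intro i
    ext s hs
    by_cases h : z i ∈ s <;> simp [h, hs]
  unfold integral diracCombination
  simp only [key]
  rw [VectorMeasure.integral_finsetSum_vectorMeasure]
  · refine Finset.sum_congr rfl fun i _ => ?_
    rw [VectorMeasure.integral_dirac]
    simp [mul_comm]
  · intro i _
    unfold VectorMeasure.Integrable
    rw [VectorMeasure.variation_dirac]
    exact (integrable_dirac (by simp)).smul_measure (by simp)

/-- The Kannappan-Wilson functional equation
`∫ f(x y t) dμ(t) + ∫ f(σ(y) x t) dμ(t) = 2 f(x) g(y)` for all `x, y`. -/
def KannappanWilsonEq {S : Type*} [Semigroup S] [MeasurableSpace S] (σ : S ≃* S)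
    (μ : ComplexMeasure S) (f g : S → ℂ) : Prop :=
  ∀ x y : S, integral μ (fun t => f (x * y * t)) + integral μ (fun t => f (σ y * x * t))
    = 2 * f x * g y

end KannappanWilson

/-! Let F be the average of f and G the average of F. The points z_i are central, so averaging
preserves the equation: (F, f) and (G, F) satisfy the same Wilson-type equation with the same g. It
gives G(xyz) - G(xzy) = F(x)(g(yz) - g(zy)). If g(ab) ≠ g(ba), right translations by a and b act on
F as scalars, hence commute on G, which is absurd. So g is central, and since g ≠ 0, commutativity
descends from G through F to f (`isAbelian_left_of_wilson`).

With f abelian, F = τf for some τ ≠ 0; then γ = g/τ solves d'Alembert's equation and f solves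
Wilson's equation with γ (`exists_wilson_scaling`). Right translation T by a satisfies T² - 2γ(a)T +
γ(aσ(a)) = 0. If the discriminant is nonzero for some a, eigenvectors of T produce χ and χ*
(`exists_multiplicative_of_dalembert`). If it always vanishes, γ is multiplicative and the odd part
of f obeys the sine law (`exists_sine_of_dalembert`). Substituting into F = τf yields the conditions
on the integrals. -/

namespace KannappanWilson

/-! ### Averages over central points and identities for Wilson-type equations -/

section Semigroup

variable {S : Type*} [Semigroup S]

/-- The function `x ↦ ∑ i, c i * h (x * z i)`. -/
noncomputable def average {I : Type*} [Fintype I] (c : I → ℂ) (z : I → S) (h : S → ℂ) (x : S) : ℂ :=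
  ∑ i, c i * h (x * z i)

/-- The Wilson-type equation for `F`, `f`, `g` forces
`F (x y z)` to be expressed by products of `f` and `g`. -/
theorem apply_mul_mul_of_wilson {σ : S ≃* S} {F f g : S → ℂ}
    (h : ∀ x y, F (x * y) + F (σ y * x) = 2 * f x * g y) (x y z : S) :
    F (x * y * z) = f x * g (y * z) + f (x * y) * g z - f (σ z * x) * g y := by
  have h1 := h x (y * z)
  have h2 := h (σ z * x) y
  have h3 := h (x * y) z
  simp only [map_mul, ← mul_assoc] at h1 h2 h3
  linear_combination (h1 - h2 + h3) / 2

/-- Swapping y and z in the expansion of G(xyz) leaves, besides the commutator of g, terms that `hF`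
turns into 2f(x)g(y)g(z) with opposite signs. -/
theorem mul_right_comm_defect {σ : S ≃* S} {G F f g : S → ℂ}
    (hF : ∀ x y, F (x * y) + F (σ y * x) = 2 * f x * g y)
    (hG : ∀ x y, G (x * y) + G (σ y * x) = 2 * F x * g y) (x y z : S) :
    G (x * y * z) - G (x * z * y) = F x * (g (y * z) - g (z * y)) := by
  linear_combination apply_mul_mul_of_wilson hG x y z - apply_mul_mul_of_wilson hG x z y
    - g y * hF x z + g z * hF x y

/-- The difference G(xyzy) - G(xyyz) is read off in two ways, grouping as x, yz, y or as xy, z, y.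
-/
theorem defect_apply_mul {G F : S → ℂ} {D : S → S → ℂ}
    (h : ∀ x y z, G (x * y * z) - G (x * z * y) = F x * D y z) (x y z : S) :
    F (x * y) * D z y = F x * D (y * z) y := by
  have h1 := h x (y * z) y
  have h2 := h (x * y) z y
  simp only [← mul_assoc] at h1 h2
  linear_combination h1 - h2

theorem average_mul_right {I : Type*} [Fintype I] {c : I → ℂ} {z : I → S}
    (hz : ∀ i x, x * z i = z i * x) (h : S → ℂ) (x y : S) :
    average c z h (x * y) = ∑ i, c i * h (x * z i * y) := by
  refine Finset.sum_congr rfl fun i _ => ?_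
  rw [mul_assoc, hz i y, ← mul_assoc]

theorem average_wilson {I : Type*} [Fintype I] {c : I → ℂ} {z : I → S}
    (hz : ∀ i x, x * z i = z i * x) {σ : S ≃* S} {F f g : S → ℂ}
    (h : ∀ x y, F (x * y) + F (σ y * x) = 2 * f x * g y) (x y : S) :
    average c z F (x * y) + average c z F (σ y * x) = 2 * average c z f x * g y := by
  rw [average_mul_right hz]
  simp only [average, Finset.mul_sum, Finset.sum_mul, ← Finset.sum_add_distrib]
  refine Finset.sum_congr rfl fun i _ => ?_
  rw [mul_assoc (σ y)]
  linear_combination c i * h (x * z i) y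

theorem average_apply_mul_of_eigen {I : Type*} [Fintype I] {c : I → ℂ} {z : I → S}
    (hz : ∀ i x, x * z i = z i * x) {F : S → ℂ} {y : S} {k : ℂ}
    (h : ∀ x, F (x * y) = k * F x) (x : S) :
    average c z F (x * y) = k * average c z F x := by
  rw [average_mul_right hz, average, Finset.mul_sum]
  refine Finset.sum_congr rfl fun i _ => ?_
  rw [h]; ring

/-! ### Commutativity of nontrivial solutions -/

section Wilson

variable {I : Type*} [Fintype I] {c : I → ℂ} {z : I → S} {σ : S ≃* S} {f g : S → ℂ}

theorem average_ne_zero_of_wilson (hf : f ≠ 0) (hg : g ≠ 0)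
    (h : ∀ x y, average c z f (x * y) + average c z f (σ y * x) = 2 * f x * g y) :
    ∃ x, average c z f x ≠ 0 := by
  obtain ⟨a, ha⟩ := Function.ne_iff.mp hf
  obtain ⟨b, hb⟩ := Function.ne_iff.mp hg
  by_contra! H
  have := h a b
  simp only [H] at this
  simp_all

theorem isCentral_right_of_wilson (hz : ∀ i x, x * z i = z i * x) (hf : f ≠ 0) (hg : g ≠ 0)
    (h : ∀ x y, average c z f (x * y) + average c z f (σ y * x) = 2 * f x * g y) :
    IsCentral g := by
  by_contra H
  simp only [IsCentral, not_forall] at H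
  obtain ⟨a, b, hab⟩ := H
  set F := average c z f
  have hG := mul_right_comm_defect h (average_wilson hz h)
  have key := defect_apply_mul (D := fun y z => g (y * z) - g (z * y)) hG
  -- Dividing `key` by the nonzero commutator shows that right translation by `q` is a scalar on
  -- `F`.
  have eigen : ∀ p q, g (p * q) ≠ g (q * p) → ∃ k, ∀ x, F (x * q) = k * F x := by
    intro p q hpq
    have hpq := sub_ne_zero.mpr hpq
    refine ⟨(g (q * p * q) - g (q * (q * p))) / (g (p * q) - g (q * p)), fun x => ?_⟩
    have := key x q p
    field_simp
    linear_combination this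
  obtain ⟨k, hk⟩ := eigen a b hab
  obtain ⟨l, hl⟩ := eigen b a (Ne.symm hab)
  obtain ⟨x, hx⟩ := average_ne_zero_of_wilson hf hg h
  have h1 := hG x a b
  rw [average_apply_mul_of_eigen hz hk, average_apply_mul_of_eigen hz hl,
    average_apply_mul_of_eigen hz hl, average_apply_mul_of_eigen hz hk] at h1
  have h2 : F x * (g (a * b) - g (b * a)) = 0 := by rw [← h1]; ring
  exact (mul_ne_zero hx (sub_ne_zero.mpr hab)) h2

theorem mul_right_comm_of_wilson {G F : S → ℂ} (hg : g ≠ 0)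
    (h : ∀ x y, G (x * y) + G (σ y * x) = 2 * F x * g y)
    (hG : ∀ x y z, G (x * y * z) = G (x * z * y)) (x y z : S) :
    F (x * y * z) = F (x * z * y) := by
  obtain ⟨w, hw⟩ := Function.ne_iff.mp hg
  have h1 := h (x * y * z) w
  have h2 := h (x * z * y) w
  have h3 : G (x * y * z * w) = G (x * z * y * w) := by
    rw [mul_assoc x, hG x, ← mul_assoc, hG, mul_assoc (x * w), ← hG x, ← mul_assoc x]
  have h4 : G (σ w * (x * y * z)) = G (σ w * (x * z * y)) := by
    simp only [← mul_assoc]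
    exact hG _ _ _
  have : g w * (F (x * y * z) - F (x * z * y)) = 0 := by
    linear_combination (h2 - h1 + h3 + h4) / 2
  rcases mul_eq_zero.mp this with h0 | h0
  · exact absurd h0 hw
  · exact sub_eq_zero.mp h0

theorem sub_swap_of_wilson {G F : S → ℂ}
    (h : ∀ x y, G (x * y) + G (σ y * x) = 2 * F x * g y)
    (hG : ∀ x y z, G (x * y * z) = G (x * z * y)) (x y z : S) :
    G (x * y * z) - G (y * x * z) = 2 * (F (x * y) - F (y * x)) * g z := by
  have e1 := h (x * y) z
  have e2 := h (y * x) z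
  have e3 := hG (σ z) x y
  simp only [← mul_assoc] at e1 e2
  linear_combination e1 - e2 - e3

/-- The commutator E(x,y) = F(xy) - F(yx) satisfies E(x,z)g(y) = E(x,y)g(z). Where g(a) ≠ 0, E(a,a)
= 0 forces E(a,·) = 0; antisymmetry and the same relation then kill E. -/
theorem isCentral_middle_of_wilson {G F : S → ℂ} (hg : g ≠ 0)
    (hF : ∀ x y, F (x * y) + F (σ y * x) = 2 * f x * g y)
    (h : ∀ x y, G (x * y) + G (σ y * x) = 2 * F x * g y)
    (hG : ∀ x y z, G (x * y * z) = G (x * z * y)) : IsCentral F := by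
  obtain ⟨a, ha⟩ := Function.ne_iff.mp hg
  have ha : g a ≠ 0 := ha
  obtain ⟨E, hE⟩ : ∃ E : S → S → ℂ, ∀ x y, E x y = F (x * y) - F (y * x) := ⟨_, fun _ _ => rfl⟩
  have h1 : ∀ x y z, G (x * y * z) - G (y * x * z) = 2 * E x y * g z := by
    intro x y z
    rw [hE]
    exact sub_swap_of_wilson h hG x y z
  have h2 : ∀ x y z,
      G (x * y * z) + G (x * y * σ z) = 2 * F (x * y) * g z + 2 * E x (σ z) * g y := by
    intro x y z
    have := h (x * y) z
    rw [← mul_assoc] at this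
    linear_combination this + h1 x (σ z) y + hG x y (σ z)
  have h3 : ∀ x y, F (x * y) + F (x * σ y) = 2 * f x * g y + E x (σ y) := by
    intro x y
    rw [hE]
    linear_combination hF x y
  have h4 : ∀ x y z, E x z * g y = E x y * g z := by
    intro x y z
    obtain ⟨y, rfl⟩ := σ.surjective y
    obtain ⟨z, rfl⟩ := σ.surjective z
    linear_combination (h2 x z y + h2 x (σ z) y - h2 x y z - h2 x (σ y) z) / 2
      + g y * h3 x z - g z * h3 x y + (hG x y z + hG x (σ y) z + hG x y (σ z)
        + hG x (σ y) (σ z)) / 2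
  have hE0 : ∀ y, E a y = 0 := by
    intro y
    have h5 := h4 a a y
    have h6 : E a a = 0 := by rw [hE, sub_self]
    rw [h6, zero_mul] at h5
    exact (mul_eq_zero.mp h5).resolve_right ha
  intro x y
  have h7 : E x a = 0 := by
    have := hE0 x
    rw [hE] at this ⊢
    linear_combination -this
  have h8 := h4 x a y
  rw [h7, zero_mul] at h8
  have h9 := (mul_eq_zero.mp h8).resolve_right ha
  rw [hE] at h9
  exact sub_eq_zero.mp h9

theorem isCentral_left_of_wilson {F : S → ℂ} (hg : g ≠ 0)
    (h : ∀ x y, F (x * y) + F (σ y * x) = 2 * f x * g y) (hF : IsAbelian F) : IsCentral f := by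
  obtain ⟨a, ha⟩ := Function.ne_iff.mp hg
  intro x y
  have h1 := sub_swap_of_wilson h hF.2 x y a
  have h2 : F (x * y * a) = F (y * x * a) := by
    rw [mul_assoc, hF.1 x, hF.2]
  rw [h2, sub_self] at h1
  have h3 : (f (x * y) - f (y * x)) * g a = 0 := by linear_combination -h1 / 2
  exact sub_eq_zero.mp ((mul_eq_zero.mp h3).resolve_right ha)

/-- In a non-trivial solution of the Kannappan-Wilson equation the first function is abelian. -/
theorem isAbelian_left_of_wilson (hz : ∀ i x, x * z i = z i * x) (hf : f ≠ 0) (hg : g ≠ 0)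
    (h : ∀ x y, average c z f (x * y) + average c z f (σ y * x) = 2 * f x * g y) :
    IsAbelian f := by
  have hgc := isCentral_right_of_wilson hz hf hg h
  have hG := average_wilson (c := c) hz h
  have h1 : ∀ x y w, average c z (average c z f) (x * y * w)
      = average c z (average c z f) (x * w * y) := by
    intro x y w
    have := mul_right_comm_defect h hG x y w
    rw [hgc y w, sub_self, mul_zero] at this
    exact sub_eq_zero.mp this
  have h2 := mul_right_comm_of_wilson hg hG h1
  exact ⟨isCentral_left_of_wilson hg h ⟨isCentral_middle_of_wilson hg h hG h1, h2⟩,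
    mul_right_comm_of_wilson hg h h2⟩

end Wilson

theorem IsAbelian.mul_mul_swap {f : S → ℂ} (hf : IsAbelian f) (x y z : S) :
    f (x * y * z) = f (y * x * z) := by
  rw [mul_assoc, hf.1 x, hf.2]

theorem IsAbelian.mul_left {f : S → ℂ} (hf : IsAbelian f) (x y z : S) :
    f (x * (y * z)) = f (x * (z * y)) := by
  rw [← mul_assoc, hf.2, mul_assoc]

/-- An abelian function is invariant under the exchange of inner factors. -/
theorem IsAbelian.mul_mul_mul_comm {f : S → ℂ} (hf : IsAbelian f) (x y z w : S) :
    f (x * y * z * w) = f (x * z * y * w) := by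
  rw [mul_assoc x y z, hf.2, hf.mul_left, hf.2, mul_assoc x z y]

theorem IsAbelian.average {I : Type*} [Fintype I] {c : I → ℂ} {z : I → S}
    {f : S → ℂ} (hf : IsAbelian f) :
    IsAbelian (average c z f) := by
  constructor
  · intro x y
    refine Finset.sum_congr rfl fun i _ => ?_
    rw [hf.mul_mul_swap]
  · intro x y w
    refine Finset.sum_congr rfl fun i _ => ?_
    rw [hf.mul_mul_mul_comm]

/-! ### Wilson's and d'Alembert's equations for abelian functions -/

section DAlembert

variable {σ : S ≃* S} {f γ : S → ℂ}

theorem apply_mul_mul_of_dalembert (hf : IsAbelian f)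
    (h : ∀ x y, f (x * y) + f (x * σ y) = 2 * f x * γ y) (x y z : S) :
    f (x * y * z) = f x * γ (y * z) + f (x * y) * γ z + f (x * z) * γ y - 2 * f x * γ y * γ z := by
  have h1 := h x (y * z)
  have h2 := h (x * σ y) z
  have h3 := h (x * z) y
  have h4 := h x y
  rw [map_mul, ← mul_assoc, ← mul_assoc] at h1
  linear_combination (h1 - h2 + h3) / 2 - γ z * h4 + (hf.2 x y z + hf.2 x (σ y) z) / 2

/-- Up to order aσ(a) is fixed by σ, so f(xaσ(a)) = f(x)γ(aσ(a)). The result is a quadratic equation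
for right translation by a; when d² = γ(a)² - γ(aσ(a)) ≠ 0, the normalised shift squares to the
identity. -/
theorem sq_shift_of_dalembert (hf : IsAbelian f) (hσ : ∀ x, σ (σ x) = x)
    (h : ∀ x y, f (x * y) + f (x * σ y) = 2 * f x * γ y) (x a : S) :
    f (x * a * a) = 2 * γ a * f (x * a) - γ (a * σ a) * f x := by
  have h1 := h (x * a) a
  have h2 := h x (a * σ a)
  rw [map_mul, hσ, ← mul_assoc, ← mul_assoc, hf.2 x (σ a)] at h2
  linear_combination h1 - h2 / 2

/-- The normalised shift `x ↦ (f (x a) - γ a * f x) / d`. -/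
noncomputable def shift (γ : S → ℂ) (a : S) (d : ℂ) (f : S → ℂ) (x : S) : ℂ :=
  (f (x * a) - γ a * f x) / d

variable {a : S} {d : ℂ}

/-- Compares the three-factor expansion of f(xa·y·a) with the quadratic relation at xy. For γ = cosh
and d = sinh a the shift of γ is sinh, and this is the addition formula. -/
theorem apply_mul_of_shift (hf : IsAbelian f) (hσ : ∀ x, σ (σ x) = x)
    (h : ∀ x y, f (x * y) + f (x * σ y) = 2 * f x * γ y) (hd : d ≠ 0)
    (hda : d * d = γ a ^ 2 - γ (a * σ a)) (x y : S) :
    f (x * y) = f x * γ y + shift γ a d f x * shift γ a d γ y := by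
  have e1 := apply_mul_mul_of_dalembert hf h (x * a) y a
  have e2 := sq_shift_of_dalembert hf hσ h (x * y) a
  have e3 := sq_shift_of_dalembert hf hσ h x a
  have e4 := apply_mul_mul_of_dalembert hf h x y a
  rw [hf.2 x a y] at e1
  have key : d * d * (f (x * y) - f x * γ y)
      = (f (x * a) - γ a * f x) * (γ (y * a) - γ a * γ y) := by
    linear_combination (f (x * y) - f x * γ y) * hda + e1 - e2 + γ y * e3 - γ a * e4
      + hf.mul_mul_mul_comm x y a a
  unfold shift
  field_simp
  linear_combination key

theorem shift_mul (hf : IsAbelian f) (hσ : ∀ x, σ (σ x) = x)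
    (h : ∀ x y, f (x * y) + f (x * σ y) = 2 * f x * γ y) (hd : d ≠ 0)
    (hda : d * d = γ a ^ 2 - γ (a * σ a)) (x y : S) :
    shift γ a d f (x * y) = shift γ a d f x * γ y + f x * shift γ a d γ y := by
  have e1 := apply_mul_mul_of_dalembert hf h x y a
  have e2 := apply_mul_of_shift hf hσ h hd hda x y
  unfold shift at e2 ⊢
  field_simp at e2 ⊢
  have e3 : f (x * y * a) = f x * γ (y * a) + f (x * y) * γ a + f (x * a) * γ y
      - 2 * f x * γ y * γ a := e1
  linear_combination e3

theorem shift_central (hf : IsAbelian f) (x y : S) :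
    shift γ a d f (x * y) = shift γ a d f (y * x) := by
  unfold shift
  rw [hf.mul_mul_swap, hf.1 x y]

theorem eq_smul_of_apply_mul {h χ : S → ℂ} (hc : ∀ x y, h (x * y) = h (y * x))
    (hχ : χ ≠ 0) (hm : ∀ x y, h (x * y) = h x * χ y) : ∃ k : ℂ, h = k • χ := by
  obtain ⟨b, hb⟩ := Function.ne_iff.mp hχ
  have hb : χ b ≠ 0 := hb
  refine ⟨h b / χ b, funext fun x => ?_⟩
  have := hc x b
  rw [hm, hm] at this
  simp only [Pi.smul_apply, smul_eq_mul]
  field_simp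
  exact this

/-- Solutions when `γ (a * σ a) ≠ γ a ^ 2` for some `a`. -/
theorem exists_multiplicative_of_dalembert (hf : IsAbelian f) (hγ : IsAbelian γ)
    (hσ : ∀ x, σ (σ x) = x) (hγ0 : γ ≠ 0) (hev : ∀ x, γ (σ x) = γ x)
    (h : ∀ x y, f (x * y) + f (x * σ y) = 2 * f x * γ y)
    (hγd : ∀ x y, γ (x * y) + γ (x * σ y) = 2 * γ x * γ y)
    (ha : γ (a * σ a) ≠ γ a ^ 2) :
    ∃ (χ : S → ℂ) (α β : ℂ), IsMultiplicative χ ∧ f = α • χ + β • starFun σ χ ∧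
      γ = (1 / 2 : ℂ) • (χ + starFun σ χ) := by
  obtain ⟨d, hda⟩ := IsAlgClosed.exists_eq_mul_self (γ a ^ 2 - γ (a * σ a))
  have hd : d ≠ 0 := by
    rintro rfl
    rw [mul_zero, sub_eq_zero] at hda
    exact ha hda.symm
  obtain ⟨s, hs⟩ : ∃ s, s = shift γ a d γ := ⟨_, rfl⟩
  obtain ⟨u, hu⟩ : ∃ u, u = shift γ a d f := ⟨_, rfl⟩
  have hγm := apply_mul_of_shift hγ hσ hγd hd hda.symm
  have hsm := shift_mul hγ hσ hγd hd hda.symm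
  have hfm := apply_mul_of_shift hf hσ h hd hda.symm
  have hum := shift_mul hf hσ h hd hda.symm
  have huc := shift_central (γ := γ) (a := a) (d := d) hf
  have hodd : ∀ x, s (σ x) = -s x := by
    intro x
    have e1 := hev (x * σ a)
    have e2 := hγd x a
    rw [map_mul, hσ] at e1
    rw [hs]
    unfold shift
    rw [hev, e1]
    field_simp
    linear_combination e2
  rw [← hs] at hγm hsm hfm hum
  rw [← hu] at hfm hum huc
  have hstar : starFun σ (γ + s) = γ - s := by
    funext x
    simp only [starFun, Pi.add_apply, Pi.sub_apply, hev, hodd]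
    ring
  have hne : ∀ χ : S → ℂ, χ + starFun σ χ = (2 : ℂ) • γ → χ ≠ 0 := by
    rintro χ hχ rfl
    apply hγ0
    funext x
    have := congrFun hχ x
    simpa [starFun] using this.symm
  have h1 : γ + s ≠ 0 := hne _ (by rw [hstar]; funext x; simp; ring)
  have h2 : γ - s ≠ 0 := by
    refine hne _ ?_
    funext x
    simp only [starFun, Pi.add_apply, Pi.sub_apply, Pi.smul_apply, smul_eq_mul, hev, hodd]
    ring
  -- Adding and subtracting the addition formulas gives (f ± u)(xy) = (f ± u)(x)(γ ± s)(y), and f ±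
  -- u is central.
  obtain ⟨α, hα⟩ := eq_smul_of_apply_mul (h := f + u)
    (fun x y => by simp only [Pi.add_apply, hf.1 x y, huc x y]) h1
    (fun x y => by simp only [Pi.add_apply, hfm x y, hum x y]; ring)
  obtain ⟨β, hβ⟩ := eq_smul_of_apply_mul (h := f - u)
    (fun x y => by simp only [Pi.sub_apply, hf.1 x y, huc x y]) h2
    (fun x y => by simp only [Pi.sub_apply, hfm x y, hum x y]; ring)
  refine ⟨γ + s, α / 2, β / 2, fun x y => ?_, ?_, ?_⟩
  · simp only [Pi.add_apply, hγm, hsm]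
    ring
  · rw [hstar]
    funext x
    have e1 := congrFun hα x
    have e2 := congrFun hβ x
    simp only [Pi.add_apply, Pi.sub_apply, Pi.smul_apply, smul_eq_mul] at e1 e2 ⊢
    linear_combination (e1 + e2) / 2
  · rw [hstar]
    funext x
    simp only [Pi.add_apply, Pi.sub_apply, Pi.smul_apply, smul_eq_mul]
    ring

/-- The numbers γ(xy) and γ(xσ(y)) have sum 2γ(x)γ(y) and product γ(x)²γ(y)², so they coincide. -/
theorem isMultiplicative_of_dalembert (hγ : IsAbelian γ) (hσ : ∀ x, σ (σ x) = x)
    (hγd : ∀ x y, γ (x * y) + γ (x * σ y) = 2 * γ x * γ y)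
    (ha : ∀ a, γ (a * σ a) = γ a ^ 2) : IsMultiplicative γ := by
  intro x y
  have hsq : ∀ x, γ (x * x) = γ x ^ 2 := by
    intro x
    linear_combination hγd x x - ha x
  have hmix : ∀ x y, γ (x * x * (y * σ y)) = γ x ^ 2 * γ y ^ 2 := by
    intro x y
    have e1 := hγd (x * x) (y * σ y)
    rw [map_mul, hσ, hγ.mul_left (x * x) (σ y), hsq, ha] at e1
    linear_combination e1 / 2
  have h1 := hγd x y
  have h2 := hγd (x * y) (x * σ y)
  rw [map_mul, hσ] at h2
  have e1 : γ (x * y * (x * σ y)) = γ (x * x * (y * σ y)) := by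
    rw [← mul_assoc, ← mul_assoc, hγ.mul_mul_mul_comm]
  have e2 : γ (x * y * (σ x * y)) = γ (y * y * (x * σ x)) := by
    rw [hγ.mul_left, hγ.mul_mul_swap, ← mul_assoc, ← mul_assoc, hγ.mul_mul_mul_comm]
  rw [e1, e2, hmix, hmix] at h2
  have h3 : (γ (x * y) - γ (x * σ y)) ^ 2 = 0 := by
    linear_combination (γ (x * y) + γ (x * σ y) + 2 * γ x * γ y) * h1 + 2 * h2
  have h4 := pow_eq_zero_iff two_ne_zero |>.mp h3
  linear_combination (h1 + h4) / 2

/-- Solutions when `γ` is multiplicative. -/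
theorem exists_sine_of_dalembert (hf : IsAbelian f) (hγm : IsMultiplicative γ)
    (hσ : ∀ x, σ (σ x) = x) (hγ0 : γ ≠ 0) (hev : ∀ x, γ (σ x) = γ x)
    (h : ∀ x y, f (x * y) + f (x * σ y) = 2 * f x * γ y) :
    ∃ (k : ℂ) (φ : S → ℂ), SineAdditionLaw φ γ ∧ starFun σ φ = -φ ∧ f = k • γ + φ := by
  obtain ⟨b, hb⟩ := Function.ne_iff.mp hγ0
  have hb : γ b ≠ 0 := hb
  -- The even part of `f` is proportional to `γ`; `φ` is then the odd part.
  have hsym : ∀ x y, (f x + f (σ x)) * γ y = (f y + f (σ y)) * γ x := by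
    intro x y
    linear_combination (-h x y - h (σ x) y + h y x + h (σ y) x + hf.1 x y + hf.1 (σ x) y
      + hf.1 x (σ y) + hf.1 (σ x) (σ y)) / 2
  obtain ⟨k, hk⟩ : ∃ k, ∀ x, f (σ x) = 2 * k * γ x - f x := by
    refine ⟨(f b + f (σ b)) / (2 * γ b), fun x => ?_⟩
    have := hsym x b
    field_simp
    linear_combination this
  refine ⟨k, fun x => f x - k * γ x, fun x y => ?_, funext fun x => ?_, funext fun x => ?_⟩
  · have e1 := h x y
    have e2 := h y x
    have e3 := hk (x * σ y)
    have e4 := hf.1 (σ x) y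
    have e5 := hf.1 x y
    rw [map_mul, hσ, hγm, hev] at e3
    simp only [hγm x y]
    linear_combination (e1 + e2 - e3 + e4 + e5) / 2
  · simp only [starFun, Pi.neg_apply, hev, hk]
    ring
  · simp

end DAlembert

/-! ### Reduction to Wilson's equation and determination of the integrals -/

section Classification

variable {I : Type*} [Fintype I] {c : I → ℂ} {z : I → S} {σ : S ≃* S} {f g : S → ℂ}

theorem isAbelian_right_of_wilson {F : S → ℂ} (hf : f ≠ 0) (hF : IsAbelian F)
    (h : ∀ x y, F (x * y) + F (σ y * x) = 2 * f x * g y) : IsAbelian g := by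
  obtain ⟨a, ha⟩ := Function.ne_iff.mp hf
  have ha : f a ≠ 0 := ha
  have hperm : ∀ x y, (∀ w, F (w * x) = F (w * y)) → (∀ w, F (w * σ x) = F (w * σ y)) →
      g x = g y := by
    intro x y h1 h2
    apply mul_left_cancel₀ ha
    linear_combination (h a y - h a x + h1 a + h2 a + hF.1 (σ x) a - hF.1 (σ y) a) / 2
  refine ⟨fun x y => hperm _ _ (fun w => hF.mul_left w x y) fun w => ?_,
    fun x y z => hperm _ _ (fun w => ?_) fun w => ?_⟩
  · rw [map_mul, map_mul, hF.mul_left]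
  · simp only [← mul_assoc]
    rw [hF.2]
  · simp only [map_mul, ← mul_assoc]
    rw [hF.2]

/-- A non-trivial solution of the Kannappan-Wilson equation is, up to scaling `g`,
a solution of the Wilson equation. -/
theorem exists_wilson_scaling (hz : ∀ i x, x * z i = z i * x) (hσ : ∀ x, σ (σ x) = x)
    (hf : f ≠ 0) (hg : g ≠ 0)
    (h : ∀ x y, average c z f (x * y) + average c z f (σ y * x) = 2 * f x * g y) :
    ∃ τ : ℂ, τ ≠ 0 ∧ (∀ x, average c z f x = τ * f x) ∧ (∀ x, g (σ x) = g x) ∧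
      (∀ x y, τ * (f (x * y) + f (x * σ y)) = 2 * f x * g y) ∧
      ∀ x y, τ * (g (x * y) + g (x * σ y)) = 2 * g x * g y := by
  have hab := isAbelian_left_of_wilson hz hf hg h
  have hF := hab.average (c := c) (z := z)
  have hG := hF.average (c := c) (z := z)
  have h2 := average_wilson (c := c) hz h
  obtain ⟨a, ha⟩ := Function.ne_iff.mp hf
  have ha : f a ≠ 0 := ha
  obtain ⟨b, hb⟩ := Function.ne_iff.mp hg
  have hb : g b ≠ 0 := hb
  -- Two applications of the averaged equation, regrouped over xy and xσ(y), make the average of `f`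
  -- proportional to `f`, once the factor at `b, b` is known to be nonzero.
  have hprod : ∀ w x y, 2 * g x * g y * f w = (g (x * y) + g (x * σ y)) * average c z f w := by
    intro w x y
    have e1 := h2 (w * x) y
    have e2 := h2 (w * σ x) y
    have e3 := h2 w (x * y)
    have e4 := h2 w (x * σ y)
    rw [hG.1 (σ _)] at e1 e2 e3 e4
    simp only [map_mul, hσ, ← mul_assoc] at e1 e2 e3 e4
    have e5 := h w x
    rw [hF.1 (σ _)] at e5
    linear_combination (e3 + e4 - e1 - e2) / 2 - g y * e5
  have heven : ∀ x, g (σ x) = g x := by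
    intro x
    have e1 := h a x
    have e2 := h a (σ x)
    rw [hσ] at e2
    apply mul_left_cancel₀ ha
    linear_combination (e1 - e2 + hF.1 a (σ x) - hF.1 a x) / 2
  have hne : g (b * b) + g (b * σ b) ≠ 0 := by
    intro h0
    have := hprod a b b
    rw [h0, zero_mul] at this
    exact mul_ne_zero (mul_ne_zero (mul_ne_zero two_ne_zero hb) hb) ha this
  obtain ⟨τ, hτ⟩ : ∃ τ : ℂ, ∀ x, average c z f x = τ * f x := by
    refine ⟨2 * g b * g b / (g (b * b) + g (b * σ b)), fun x => ?_⟩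
    have := hprod x b b
    field_simp
    linear_combination -this
  have hτ0 : τ ≠ 0 := by
    rintro rfl
    obtain ⟨x, hx⟩ := average_ne_zero_of_wilson hf hg h
    exact hx (by rw [hτ, zero_mul])
  refine ⟨τ, hτ0, hτ, heven, fun x y => ?_, fun x y => ?_⟩
  · have := h x y
    rw [hF.1 (σ y), hτ, hτ] at this
    linear_combination this
  · have := hprod a x y
    rw [hτ] at this
    apply mul_left_cancel₀ ha
    linear_combination -this

theorem average_of_isMultiplicative {m : S → ℂ} (hm : IsMultiplicative m) (x : S) :
    average c z m x = (∑ i, c i * m (z i)) * m x := by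
  rw [average, Finset.sum_mul]
  refine Finset.sum_congr rfl fun i _ => ?_
  rw [hm]; ring

theorem average_of_sineAdditionLaw {φ χ : S → ℂ} (hφ : SineAdditionLaw φ χ) (x : S) :
    average c z φ x = (∑ i, c i * χ (z i)) * φ x + (∑ i, c i * φ (z i)) * χ x := by
  rw [average, Finset.sum_mul, Finset.sum_mul, ← Finset.sum_add_distrib]
  refine Finset.sum_congr rfl fun i _ => ?_
  rw [hφ]; ring

theorem average_linear (α β : ℂ) (f g : S → ℂ) (x : S) :
    average c z (α • f + β • g) x = α * average c z f x + β * average c z g x := by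
  simp only [average, Finset.mul_sum, ← Finset.sum_add_distrib, Pi.add_apply, Pi.smul_apply,
    smul_eq_mul]
  refine Finset.sum_congr rfl fun i _ => ?_
  ring

theorem IsMultiplicative.starFun {m : S → ℂ} (hm : IsMultiplicative m) (σ : S ≃* S) :
    IsMultiplicative (starFun σ m) := fun x y => by
  simp only [KannappanWilson.starFun, map_mul, hm _ _]

theorem starFun_starFun (hσ : ∀ x, σ (σ x) = x) (m : S → ℂ) : starFun σ (starFun σ m) = m :=
  funext fun x => by simp only [starFun, hσ]

/-- Distinct multiplicative functions, the second one non-zero, have no linear relation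
in which the second one occurs. -/
theorem coeff_eq_zero_of_isMultiplicative {χ ψ : S → ℂ} (hχ : IsMultiplicative χ)
    (hψ : IsMultiplicative ψ) (hne : χ ≠ ψ) (hψ0 : ψ ≠ 0) {A B : ℂ}
    (h : ∀ x, A * χ x + B * ψ x = 0) : B = 0 := by
  obtain ⟨a, ha⟩ := Function.ne_iff.mp hne
  obtain ⟨b, hb⟩ := Function.ne_iff.mp hψ0
  have hb : ψ b ≠ 0 := hb
  have h1 := h (a * b)
  rw [hχ, hψ] at h1
  have h2 : B * (ψ b * (χ a - ψ a)) = 0 := by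
    linear_combination χ a * h b - h1
  exact (mul_eq_zero.mp h2).resolve_right (mul_ne_zero hb (sub_ne_zero.mpr ha))

/-- If m* = -m, then evaluating at x² gives m(x)² = -m(x)². -/
theorem ne_zero_of_smul_add_starFun {m : S → ℂ} (hm : IsMultiplicative m) {k : ℂ} (hk : k ≠ 0)
    (hm0 : m ≠ 0) : k • ((1 / 2 : ℂ) • (m + starFun σ m)) ≠ 0 := by
  intro h
  have h1 : ∀ x, m (σ x) = -m x := by
    intro x
    have := congrFun h x
    simp only [Pi.smul_apply, Pi.add_apply, starFun, smul_eq_mul, Pi.zero_apply] at this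
    have h2 := (mul_eq_zero.mp ((mul_eq_zero.mp this).resolve_left hk)).resolve_left (by norm_num)
    linear_combination h2
  apply hm0
  funext x
  have h2 := h1 (x * x)
  rw [map_mul, hm, hm, h1] at h2
  have h3 : m x * m x = 0 := by linear_combination h2 / 2
  simpa using h3

/-- The non-trivial solutions of the Kannappan-Wilson equation. -/
theorem classification_of_wilson (hz : ∀ i x, x * z i = z i * x) (hσ : ∀ x, σ (σ x) = x)
    (hf : f ≠ 0) (hg : g ≠ 0)
    (h : ∀ x y, average c z f (x * y) + average c z f (σ y * x) = 2 * f x * g y) :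
    (∃ (m : S → ℂ) (lam₂ : ℂ), IsMultiplicative m ∧ lam₂ ≠ 0 ∧
        (∑ i, c i * m (z i)) ≠ 0 ∧ f = lam₂ • m ∧
        g = (∑ i, c i * m (z i)) • ((1 / 2 : ℂ) • (m + starFun σ m))) ∨
      (∃ (χ : S → ℂ) (α₁ β₁ : ℂ), IsMultiplicative χ ∧ (α₁, β₁) ≠ (0, 0) ∧
        χ ≠ starFun σ χ ∧
        (∑ i, c i * χ (z i)) = (∑ i, c i * starFun σ χ (z i)) ∧
        (∑ i, c i * χ (z i)) ≠ 0 ∧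
        f = α₁ • χ + β₁ • starFun σ χ ∧
        g = (∑ i, c i * χ (z i)) • ((1 / 2 : ℂ) • (χ + starFun σ χ))) ∨
      (∃ (χ φ : S → ℂ) (lam γ₁ : ℂ), IsMultiplicative χ ∧ χ ≠ 0 ∧
        SineAdditionLaw φ χ ∧ φ ≠ 0 ∧ lam ≠ 0 ∧
        starFun σ χ = χ ∧ starFun σ φ = -φ ∧
        (∑ i, c i * χ (z i)) ≠ 0 ∧ (∑ i, c i * φ (z i)) = 0 ∧
        f = lam • (γ₁ • χ + φ) ∧ g = (∑ i, c i * χ (z i)) • χ) := by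
  have hab := isAbelian_left_of_wilson hz hf hg h
  have hgab := isAbelian_right_of_wilson hf hab.average h
  obtain ⟨τ, hτ0, hτ, hev, hfg, hgg⟩ := exists_wilson_scaling hz hσ hf hg h
  obtain ⟨γ, rfl⟩ : ∃ γ : S → ℂ, g = τ • γ := ⟨τ⁻¹ • g, by rw [smul_inv_smul₀ hτ0]⟩
  simp only [Pi.smul_apply, smul_eq_mul] at hev hfg hgg
  replace hev : ∀ x, γ (σ x) = γ x := fun x => mul_left_cancel₀ hτ0 (hev x)
  replace hfg : ∀ x y, f (x * y) + f (x * σ y) = 2 * f x * γ y := fun x y =>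
    mul_left_cancel₀ hτ0 (by linear_combination hfg x y)
  replace hgg : ∀ x y, γ (x * y) + γ (x * σ y) = 2 * γ x * γ y := fun x y =>
    mul_left_cancel₀ hτ0 (mul_left_cancel₀ hτ0 (by linear_combination hgg x y))
  have hγ0 : γ ≠ 0 := by
    rintro rfl
    exact hg (smul_zero τ)
  have hγab : IsAbelian γ := ⟨fun x y => mul_left_cancel₀ hτ0 (hgab.1 x y),
    fun x y w => mul_left_cancel₀ hτ0 (hgab.2 x y w)⟩
  have single : ∀ (m : S → ℂ) (k : ℂ), IsMultiplicative m → f = k • m →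
      k ≠ 0 ∧ (∑ i, c i * m (z i)) = τ := by
    intro m k hm hfm
    have hk : k ≠ 0 := by
      rintro rfl
      exact hf (by rw [hfm, zero_smul])
    refine ⟨hk, ?_⟩
    obtain ⟨a, ha⟩ := Function.ne_iff.mp hf
    have ha : f a ≠ 0 := ha
    have h1 := hτ a
    have h2 := average_linear (c := c) (z := z) k 0 m 0 a
    rw [zero_smul, add_zero, ← hfm, average_of_isMultiplicative hm, hτ] at h2
    have h3 : f a = k * m a := by rw [hfm]; rfl
    apply mul_right_cancel₀ ha
    linear_combination (∑ i, c i * m (z i)) * h3 - h2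
  by_cases hd : ∀ a, γ (a * σ a) = γ a ^ 2
  · have hγm := isMultiplicative_of_dalembert hγab hσ hgg hd
    have hγs : starFun σ γ = γ := funext hev
    obtain ⟨k, φ, hφ, hφs, hfφ⟩ := exists_sine_of_dalembert hab hγm hσ hγ0 hev hfg
    by_cases hφ0 : φ = 0
    · rw [hφ0, add_zero] at hfφ
      obtain ⟨hk, hM⟩ := single γ k hγm hfφ
      refine Or.inl ⟨γ, k, hγm, hk, hM ▸ hτ0, hfφ, ?_⟩
      rw [hM, hγs, ← two_smul ℂ γ, smul_smul (1 / 2 : ℂ)]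
      norm_num
    · have hrel : ∀ x, (∑ i, c i * γ (z i) - τ) * φ x
          = (k * (τ - ∑ i, c i * γ (z i)) - ∑ i, c i * φ (z i)) * γ x := by
        intro x
        have h1 := average_linear (c := c) (z := z) k 1 γ φ x
        rw [one_smul, ← hfφ, hτ, average_of_isMultiplicative hγm,
          average_of_sineAdditionLaw hφ] at h1
        have h2 : f x = k * γ x + φ x := congrFun hfφ x
        linear_combination τ * h2 - h1
      have hφσ : ∀ x, φ (σ x) = -φ x := congrFun hφs
      obtain ⟨a, ha⟩ := Function.ne_iff.mp hφ0
      have ha : φ a ≠ 0 := ha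
      obtain ⟨b, hb⟩ := Function.ne_iff.mp hγ0
      have hb : γ b ≠ 0 := hb
      -- Comparing `a` with `σ a` separates the odd function `φ` from the even `γ`.
      have hM : ∑ i, c i * γ (z i) = τ := by
        have h1 := hrel a
        have h2 := hrel (σ a)
        rw [hφσ, hev] at h2
        apply mul_right_cancel₀ ha
        linear_combination (h1 - h2) / 2
      have hΦ : ∑ i, c i * φ (z i) = 0 := by
        have h1 := hrel b
        rw [hM] at h1
        apply mul_right_cancel₀ hb
        linear_combination h1
      refine Or.inr (Or.inr ⟨γ, φ, 1, k, hγm, hγ0, hφ, hφ0, one_ne_zero, hγs, hφs, hM ▸ hτ0, hΦ,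
        ?_, ?_⟩)
      · rw [one_smul, hfφ]
      · rw [hM]
  · push Not at hd
    obtain ⟨a, ha⟩ := hd
    obtain ⟨χ, α, β, hχ, hfχ, hγχ⟩ :=
      exists_multiplicative_of_dalembert hab hγab hσ hγ0 hev hfg hgg ha
    have hχs := hχ.starFun σ
    have hχ0 : χ ≠ 0 := by
      rintro rfl
      apply hf
      rw [hfχ]
      funext x
      simp [starFun]
    -- Here, and when α = 0, `f` is a multiple of one multiplicative function; otherwise χ and χ*
    -- are independent and both integrals must equal τ.
    by_cases hαβ : β = 0 ∨ χ = starFun σ χ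
    · obtain ⟨k, hk⟩ : ∃ k : ℂ, f = k • χ := by
        rcases hαβ with rfl | hs
        · exact ⟨α, by rw [hfχ, zero_smul, add_zero]⟩
        · exact ⟨α + β, by rw [hfχ, ← hs, add_smul]⟩
      obtain ⟨hk0, hM⟩ := single χ k hχ hk
      exact Or.inl ⟨χ, k, hχ, hk0, hM ▸ hτ0, hk, by rw [hM, hγχ]⟩
    push Not at hαβ
    obtain ⟨hβ, hne⟩ := hαβ
    by_cases hα : α = 0
    · rw [hα, zero_smul, zero_add] at hfχ
      obtain ⟨hk0, hM⟩ := single _ β hχs hfχ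
      refine Or.inl ⟨starFun σ χ, β, hχs, hk0, hM ▸ hτ0, hfχ, ?_⟩
      rw [hM, starFun_starFun hσ, add_comm, hγχ]
    have hχs0 : starFun σ χ ≠ 0 := by
      intro h0
      apply hχ0
      rw [← starFun_starFun hσ χ, h0]
      rfl
    have hrel : ∀ x, α * (∑ i, c i * χ (z i) - τ) * χ x
        + β * (∑ i, c i * starFun σ χ (z i) - τ) * starFun σ χ x = 0 := by
      intro x
      have h1 := average_linear (c := c) (z := z) α β χ (starFun σ χ) x
      rw [← hfχ, hτ, average_of_isMultiplicative hχ, average_of_isMultiplicative hχs] at h1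
      have h2 : f x = α * χ x + β * starFun σ χ x := congrFun hfχ x
      linear_combination τ * h2 - h1
    have hB := coeff_eq_zero_of_isMultiplicative hχ hχs hne hχs0 hrel
    have hA := coeff_eq_zero_of_isMultiplicative hχs hχ hne.symm hχ0
      (fun x => (add_comm _ _).trans (hrel x))
    have hM := sub_eq_zero.mp ((mul_eq_zero.mp hA).resolve_left hα)
    have hMs := sub_eq_zero.mp ((mul_eq_zero.mp hB).resolve_left hβ)
    refine Or.inr (Or.inl ⟨χ, α, β, hχ, ?_, hne, hM.trans hMs.symm, hM ▸ hτ0, hfχ, ?_⟩)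
    · intro h0
      exact hα (congrArg Prod.fst h0)
    · rw [hM, hγχ]

end Classification

end Semigroup

/-! ### Return to the integral equation, and the converse -/

theorem kannappanWilsonEq_diracCombination_iff {S : Type*} [Semigroup S] [MeasurableSpace S]
    [MeasurableSingletonClass S] {σ : S ≃* S} {I : Type*} [Fintype I] {c : I → ℂ} {z : I → S}
    {f g : S → ℂ} :
    KannappanWilsonEq σ (diracCombination c z) f g ↔
      ∀ x y, average c z f (x * y) + average c z f (σ y * x) = 2 * f x * g y := by
  simp only [KannappanWilsonEq, integral_diracCombination, average]

end KannappanWilson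

theorem mainTheorem1 {S : Type*} [Semigroup S] [MeasurableSpace S] [MeasurableSingletonClass S]
    (σ : S ≃* S) (hσ : ∀ x, σ (σ x) = x)
    {I : Type*} [Fintype I] (c : I → ℂ) (z : I → S) (hz : ∀ i, z i ∈ Set.center S)
    (μ : MeasureTheory.ComplexMeasure S) (hμ : μ = KannappanWilson.diracCombination c z)
    (f g : S → ℂ) :
    ((g ≠ 0 ∧ KannappanWilson.KannappanWilsonEq σ μ f g) ↔
      (f = 0 ∧ g ≠ 0) ∨
      (∃ (m : S → ℂ) (lam₂ : ℂ), KannappanWilson.IsMultiplicative m ∧ lam₂ ≠ 0 ∧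
        KannappanWilson.integral μ m ≠ 0 ∧
        f = lam₂ • m ∧
        g = KannappanWilson.integral μ m • ((1 / 2 : ℂ) • (m + KannappanWilson.starFun σ m))) ∨
      (∃ (χ : S → ℂ) (α₁ β₁ : ℂ), KannappanWilson.IsMultiplicative χ ∧ (α₁, β₁) ≠ (0, 0) ∧
        χ ≠ KannappanWilson.starFun σ χ ∧
        KannappanWilson.integral μ χ
          = KannappanWilson.integral μ (KannappanWilson.starFun σ χ) ∧
        KannappanWilson.integral μ χ ≠ 0 ∧
        f = α₁ • χ + β₁ • KannappanWilson.starFun σ χ ∧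
        g = KannappanWilson.integral μ χ • ((1 / 2 : ℂ) • (χ + KannappanWilson.starFun σ χ))) ∨
      (∃ (χ φ : S → ℂ) (lam γ₁ : ℂ), KannappanWilson.IsMultiplicative χ ∧ χ ≠ 0 ∧
        KannappanWilson.SineAdditionLaw φ χ ∧ φ ≠ 0 ∧ lam ≠ 0 ∧
        KannappanWilson.starFun σ χ = χ ∧ KannappanWilson.starFun σ φ = -φ ∧
        KannappanWilson.integral μ χ ≠ 0 ∧ KannappanWilson.integral μ φ = 0 ∧
        f = lam • (γ₁ • χ + φ) ∧
        g = KannappanWilson.integral μ χ • χ)) ∧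
    (g ≠ 0 → KannappanWilson.KannappanWilsonEq σ μ f g → f ≠ 0 →
      KannappanWilson.IsAbelian f ∧ KannappanWilson.IsAbelian g) := by 
  subst hμ
  have hz' : ∀ i x, x * z i = z i * x := fun i x => ((hz i).comm x).symm
  simp only [KannappanWilson.kannappanWilsonEq_diracCombination_iff,
    KannappanWilson.integral_diracCombination]
  refine ⟨⟨fun ⟨hg, h⟩ => ?_, ?_⟩, fun hg h hf => ?_⟩
  · by_cases hf : f = 0
    · exact Or.inl ⟨hf, hg⟩
    · exact Or.inr (KannappanWilson.classification_of_wilson hz' hσ hf hg h)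
  · rintro (⟨rfl, hg⟩ | ⟨m, k, hm, hk, hM, rfl, rfl⟩ | ⟨χ, α, β, hχ, -, -, hs, hM, rfl, rfl⟩ |
      ⟨χ, φ, l, k, hχ, hχ0, hφ, -, -, hχs, hφs, hM, hΦ, rfl, rfl⟩)
    · exact ⟨hg, fun x y => by simp [KannappanWilson.average]⟩
    · refine ⟨KannappanWilson.ne_zero_of_smul_add_starFun hm hM ?_, fun x y => ?_⟩
      · rintro rfl
        simp at hM
      · have h1 := fun x => KannappanWilson.average_linear (c := c) (z := z) k 0 m 0 x
        simp only [zero_smul, add_zero, zero_mul,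
          KannappanWilson.average_of_isMultiplicative hm] at h1
        rw [h1, h1, hm, hm]
        simp only [Pi.smul_apply, Pi.add_apply, smul_eq_mul, KannappanWilson.starFun]
        ring
    · refine ⟨KannappanWilson.ne_zero_of_smul_add_starFun hχ hM ?_, fun x y => ?_⟩
      · rintro rfl
        simp at hM
      · rw [KannappanWilson.average_linear, KannappanWilson.average_linear]
        simp only [KannappanWilson.average_of_isMultiplicative hχ,
          KannappanWilson.average_of_isMultiplicative (hχ.starFun σ), ← hs]
        simp only [Pi.smul_apply, Pi.add_apply, smul_eq_mul, KannappanWilson.starFun, map_mul,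
          hχ _ _, hσ]
        ring
    · refine ⟨smul_ne_zero hM hχ0, fun x y => ?_⟩
      have hχσ : ∀ x, χ (σ x) = χ x := congrFun hχs
      have hφσ : ∀ x, φ (σ x) = -φ x := congrFun hφs
      rw [smul_add, smul_smul, KannappanWilson.average_linear, KannappanWilson.average_linear]
      simp only [KannappanWilson.average_of_isMultiplicative hχ,
        KannappanWilson.average_of_sineAdditionLaw hφ, hΦ, Pi.smul_apply, Pi.add_apply,
        smul_eq_mul, hχ _ _, hφ _ _, hχσ, hφσ]
      ring
  · have hab := KannappanWilson.isAbelian_left_of_wilson hz' hf hg h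
    exact ⟨hab, KannappanWilson.isAbelian_right_of_wilson hf hab.average h⟩
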